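/- Let $(\Omega,d)$ be a countable metric space (with its Borel $\sigma$-algebra, in which every subset is measurable), and let $p$ be a Markov transition kernel on $\Omega$. For probability measures $\mu,\nu$ on $\Omega$ let $W_1(\mu,\nu)=\inf \mathbb E\,[d(X,Y)]\in[0,\infty]$, the infimum over all couplings $(X,Y)$ of $(\mu,\nu)$, and let $H(\nu\mid\mu)=\int\log\frac{d\nu}{d\mu}\,d\nu$ if $\nu\ll\mu$ and $H(\nu\mid\mu)=+\infty$ otherwise. The coarse Ricci curvature of $(\Omega,p,d)$ is the largest $\kappa\in[-\infty,1]$ such that $W_1(p(x,\cdot),p(y,\cdot))\le(1-\kappa)\,d(x,y)$ for all $x,y\in\Omega$. A probability measure $\mu$ satisfies $(T_1)$ with constant $C\ge 0$ if $W_1(\mu,\nu)^2\le C\cdot H(\nu\mid\mu)$ for every probability measure $\nu$ on $\Omega$ (the inequality being void when $H(\nu\mid\mu)=+\infty$). Theorem. Let $\alpha>0$ and $C\ge 0$. Assume that $(\Omega,p,d)$ has coarse Ricci curvature at least $1/\alpha$, and that for every $x\in\Omega$ the one-step transition law $p(x,\cdot)$ satisfies $(T_1)$ with the same constant $C$. Let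 $\pi$ be a stationary probability measure of $p$, that is, $\pi p=\pi$. Then $\pi$ satisfies $(T_1)$ with constant $\dfrac{C\alpha}{2-1/\alpha}$. (Reversibility of $p$ with respect to $\pi$ is not assumed.) -/

import Mathlib

open MeasureTheory ProbabilityTheory
open scoped ENNReal

noncomputable section

/-- A coupling of `μ` and `ν`: a measure on the product with marginals `μ` and `ν`. -/
def IsCoupling {Ω : Type*} [MeasurableSpace Ω] (γ : Measure (Ω × Ω)) (μ ν : Measure Ω) : Prop :=
  γ.map Prod.fst = μ ∧ γ.map Prod.snd = ν

/-- The Wasserstein 1-distance `W₁(μ, ν) ∈ [0, ∞]`: the infimum of `𝔼 d(X, Y)` over all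
couplings `(X, Y)` of `(μ, ν)`. -/
def W1 {Ω : Type*} [MetricSpace Ω] [MeasurableSpace Ω] (μ ν : Measure Ω) : ℝ≥0∞ :=
  ⨅ (γ : Measure (Ω × Ω)) (_ : IsCoupling γ μ ν), ∫⁻ z, edist z.1 z.2 ∂γ

/-- The coarse Ricci curvature in `[-∞, 1]` of a Markov kernel `p`: the largest `κ ≤ 1` such that
`W₁(p(x, ·), p(y, ·)) ≤ (1 - κ) d(x, y)` for all `x, y` (and `-∞` if no real `κ` works). -/
def coarseRicciCurvature {Ω : Type*} [MetricSpace Ω] [MeasurableSpace Ω] (p : Kernel Ω Ω) :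
    EReal :=
  ⨆ (κ : ℝ) (_ : κ ≤ 1 ∧ ∀ x y : Ω, W1 (p x) (p y) ≤ ENNReal.ofReal (1 - κ) * edist x y),
    (κ : EReal)

/-- `μ` satisfies the transport-entropy inequality `(T₁)` with constant `C ≥ 0`:
`W₁(μ, ν)² ≤ C · H(ν | μ)` for every probability measure `ν`. The inequality is void where the
relative entropy is `+∞`; this is spelled out because `0 * ∞ = 0` in `ℝ≥0∞`. -/
def SatisfiesT1 {Ω : Type*} [MetricSpace Ω] [MeasurableSpace Ω] (μ : Measure Ω) (C : ℝ) : Prop :=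
  ∀ ν : Measure Ω, IsProbabilityMeasure ν → InformationTheory.klDiv ν μ ≠ ∞ →
    W1 μ ν ^ 2 ≤ ENNReal.ofReal C * InformationTheory.klDiv ν μ

end

/-!
The proof is a coupling argument along the stationary chain; it uses neither the dual form of
`W₁` nor reversibility. Put `r = 1 - 1/α ∈ [0, 1)` and `C' = Cα / (2 - 1/α)`, so that
`C = (1 - r²) C'`.

Let `ν ≪ π` have finite entropy, and tilt the stationary chain `(X₀, X₁)` by the density
`dν/dπ (X₁)`. Under the tilted law `X₁` has law `ν`, and `X₀` has some law `ν'`; let `q` be the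
tilted transition kernel. Read backwards in time the tilt only changes the law of `X₁`, so the chain
rule for relative entropy gives `H(ν' | π) + ∫ H(q x | p x) dν' ≤ H(ν | π)`
(`exists_kernel_klDiv_add_le`). The triangle inequality through `ν' p`, contraction, convexity of
`W₁` and `(T₁)` for each `p x` then give `W₁(π, ν) ≤ r W₁(π, ν') + √(C E)`, where `E` is the second
entropy term (`exists_W1_le_add`). Since
`√(C E) + r √(C' H') ≤ √(C' (H' + E))` by Cauchy-Schwarz, iterating gives
`W₁(π, ν) ≤ √(C' H(ν | π)) + rⁿ M`, where `M` bounds `W₁(π, ·)` along the iteration.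

Such a finite `M` exists when `ν ≤ K π`, because this bound passes from `ν` to `ν'` and `π` has a
finite first moment (`lintegral_edist_ne_top_of_invariant`); letting `n → ∞` settles this case
(`W1_le_sqrt_of_le_smul`). A general `ν` is approximated by its conditionings on the sets
`{dν/dπ ≤ n}`, along which both sides of the inequality converge
(`satisfiesT1_of_forall_le_smul`).
-/

open InformationTheory Filter Topology

/-! ### Couplings and the Wasserstein distance -/

lemma isCoupling_prod {Ω : Type*} [MeasurableSpace Ω] (μ ν : Measure Ω) [IsProbabilityMeasure μ]
    [IsProbabilityMeasure ν] : IsCoupling (μ.prod ν) μ ν :=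
  ⟨by simp [Measure.map_fst_prod], by simp [Measure.map_snd_prod]⟩

lemma IsCoupling.isProbabilityMeasure {Ω : Type*} [MeasurableSpace Ω]
    {γ : Measure (Ω × Ω)} {μ ν : Measure Ω} [IsProbabilityMeasure μ] (h : IsCoupling γ μ ν) :
    IsProbabilityMeasure γ := by
  refine ⟨?_⟩
  rw [← measure_univ (μ := μ), ← h.1, Measure.map_apply measurable_fst .univ, Set.preimage_univ]

section Wasserstein

variable {Ω : Type*} [MetricSpace Ω] [MeasurableSpace Ω]

lemma W1_le_lintegral {μ ν : Measure Ω} {γ : Measure (Ω × Ω)} (h : IsCoupling γ μ ν) :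
    W1 μ ν ≤ ∫⁻ z, edist z.1 z.2 ∂γ :=
  iInf₂_le γ h

lemma exists_isCoupling_lintegral_le (μ ν : Measure Ω) [IsProbabilityMeasure μ]
    [IsProbabilityMeasure ν] {ε : ℝ≥0∞} (hε : ε ≠ 0) :
    ∃ γ, IsCoupling γ μ ν ∧ ∫⁻ z, edist z.1 z.2 ∂γ ≤ W1 μ ν + ε := by
  by_cases hW : W1 μ ν = ∞
  · exact ⟨μ.prod ν, isCoupling_prod μ ν, by simp [hW]⟩
  · obtain ⟨γ, hγ⟩ := iInf_lt_iff.1 (ENNReal.lt_add_right hW hε)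
    obtain ⟨hc, hlt⟩ := iInf_lt_iff.1 hγ
    exact ⟨γ, hc, hlt.le⟩

variable [Countable Ω] [BorelSpace Ω]

lemma W1_le_lintegral_lintegral (μ ν : Measure Ω) [IsProbabilityMeasure μ]
    [IsProbabilityMeasure ν] :
    W1 μ ν ≤ ∫⁻ x, ∫⁻ y, edist x y ∂ν ∂μ := by
  refine (W1_le_lintegral (isCoupling_prod μ ν)).trans_eq ?_
  rw [lintegral_prod _ (Measurable.of_discrete).aemeasurable]

/-- Joint convexity of `W₁`: near-optimal couplings of `κ z` and `η z`, mixed over `z`, couple the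
two mixtures. Countability of the index space makes any choice of couplings measurable. -/
lemma W1_comp_le_lintegral {Z : Type*} [MeasurableSpace Z] [DiscreteMeasurableSpace Z]
    (γ : Measure Z) [IsProbabilityMeasure γ] (κ η : Kernel Z Ω) [IsMarkovKernel κ]
    [IsMarkovKernel η] :
    W1 (κ ∘ₘ γ) (η ∘ₘ γ) ≤ ∫⁻ z, W1 (κ z) (η z) ∂γ := by
  refine ENNReal.le_of_forall_pos_le_add fun ε hε _ ↦ ?_
  have hε' : (ε : ℝ≥0∞) ≠ 0 := by simpa using hε.ne'
  choose Γ hΓ hcost using fun z ↦ exists_isCoupling_lintegral_le (κ z) (η z) hε'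
  let G : Kernel Z (Ω × Ω) := ⟨Γ, .of_discrete⟩
  have hG : IsCoupling (G ∘ₘ γ) (κ ∘ₘ γ) (η ∘ₘ γ) := by
    constructor
    · rw [Measure.map_comp _ _ measurable_fst]
      congr 1
      ext1 z
      rw [Kernel.map_apply _ measurable_fst]
      exact (hΓ z).1
    · rw [Measure.map_comp _ _ measurable_snd]
      congr 1
      ext1 z
      rw [Kernel.map_apply _ measurable_snd]
      exact (hΓ z).2
  calc W1 (κ ∘ₘ γ) (η ∘ₘ γ) ≤ ∫⁻ z, edist z.1 z.2 ∂(G ∘ₘ γ) := W1_le_lintegral hG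
    _ = ∫⁻ z, ∫⁻ w, edist w.1 w.2 ∂(Γ z) ∂γ :=
      Measure.lintegral_bind (Kernel.aemeasurable _) Measurable.of_discrete.aemeasurable
    _ ≤ ∫⁻ z, (W1 (κ z) (η z) + ε) ∂γ := lintegral_mono hcost
    _ = ∫⁻ z, W1 (κ z) (η z) ∂γ + ε := by
      rw [lintegral_add_right _ measurable_const]; simp

/-- Two couplings sharing the marginal `ν` are disintegrated over it, and their other coordinates
are made conditionally independent given the shared one. -/
lemma W1_triangle (μ ν ρ : Measure Ω) [IsProbabilityMeasure μ] [IsProbabilityMeasure ν]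
    [IsProbabilityMeasure ρ] :
    W1 μ ρ ≤ W1 μ ν + W1 ν ρ := by
  have : Nonempty Ω := nonempty_of_isProbabilityMeasure μ
  refine ENNReal.le_of_forall_pos_le_add fun ε hε _ ↦ ?_
  have hε' : (ε / 2 : ℝ≥0∞) ≠ 0 := by simpa using hε.ne'
  obtain ⟨γ₁, h₁, c₁⟩ := exists_isCoupling_lintegral_le μ ν hε'
  obtain ⟨γ₂, h₂, c₂⟩ := exists_isCoupling_lintegral_le ν ρ hε'
  have := h₁.isProbabilityMeasure
  have := h₂.isProbabilityMeasure
  have : IsProbabilityMeasure (γ₁.map Prod.swap) :=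
    Measure.isProbabilityMeasure_map measurable_swap.aemeasurable
  -- `γ₁` is swapped so that both couplings are disintegrated over their common marginal `ν`.
  set κ₁ := (γ₁.map Prod.swap).condKernel
  set κ₂ := γ₂.condKernel
  have d₁ : ν ⊗ₘ κ₁ = γ₁.map Prod.swap := by
    have := (γ₁.map Prod.swap).disintegrate κ₁
    rwa [Measure.fst_map_swap, Measure.snd, h₁.2] at this
  have d₂ : ν ⊗ₘ κ₂ = γ₂ := by
    have := γ₂.disintegrate κ₂
    rwa [Measure.fst, h₂.1] at this
  have e₁ : κ₁ ∘ₘ ν = μ := by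
    rw [← Measure.snd_compProd, d₁, Measure.snd_map_swap, Measure.fst, h₁.1]
  have e₂ : κ₂ ∘ₘ ν = ρ := by
    rw [← Measure.snd_compProd, d₂, Measure.snd, h₂.2]
  have i₁ : ∫⁻ y, ∫⁻ x, edist x y ∂κ₁ y ∂ν = ∫⁻ z, edist z.1 z.2 ∂γ₁ := by
    rw [← Measure.lintegral_compProd (f := fun z : Ω × Ω ↦ edist z.2 z.1) .of_discrete, d₁,
      lintegral_map .of_discrete measurable_swap]
    rfl
  have i₂ : ∫⁻ y, ∫⁻ x, edist y x ∂κ₂ y ∂ν = ∫⁻ z, edist z.1 z.2 ∂γ₂ := by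
    rw [← Measure.lintegral_compProd (f := fun z : Ω × Ω ↦ edist z.1 z.2) .of_discrete, d₂]
  calc W1 μ ρ = W1 (κ₁ ∘ₘ ν) (κ₂ ∘ₘ ν) := by rw [e₁, e₂]
    _ ≤ ∫⁻ y, W1 (κ₁ y) (κ₂ y) ∂ν := W1_comp_le_lintegral ν κ₁ κ₂
    _ ≤ ∫⁻ y, (∫⁻ x, edist x y ∂κ₁ y + ∫⁻ z, edist y z ∂κ₂ y) ∂ν := by
      refine lintegral_mono fun y ↦ (W1_le_lintegral_lintegral _ _).trans ?_
      calc ∫⁻ x, ∫⁻ z, edist x z ∂κ₂ y ∂κ₁ y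
          ≤ ∫⁻ x, (edist x y + ∫⁻ z, edist y z ∂κ₂ y) ∂κ₁ y := by
            refine lintegral_mono fun x ↦ ?_
            calc ∫⁻ z, edist x z ∂κ₂ y ≤ ∫⁻ z, (edist x y + edist y z) ∂κ₂ y :=
                  lintegral_mono fun z ↦ edist_triangle x y z
              _ = _ := by rw [lintegral_add_left measurable_const]; simp
        _ = _ := by rw [lintegral_add_right _ measurable_const]; simp
    _ = ∫⁻ z, edist z.1 z.2 ∂γ₁ + ∫⁻ z, edist z.1 z.2 ∂γ₂ := by
      rw [lintegral_add_left .of_discrete, i₁, i₂]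
    _ ≤ (W1 μ ν + ε / 2) + (W1 ν ρ + ε / 2) := add_le_add c₁ c₂
    _ = W1 μ ν + W1 ν ρ + ε := by
      rw [add_add_add_comm, ENNReal.add_halves]

/-- A contraction on Dirac masses is a contraction on all probability measures. -/
lemma W1_comp_le_mul {p : Kernel Ω Ω} [IsMarkovKernel p] {r : ℝ≥0∞} (hr : r ≠ ∞)
    (h : ∀ x y, W1 (p x) (p y) ≤ r * edist x y) (μ ν : Measure Ω) [IsProbabilityMeasure μ]
    [IsProbabilityMeasure ν] :
    W1 (p ∘ₘ μ) (p ∘ₘ ν) ≤ r * W1 μ ν := by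
  have key {γ : Measure (Ω × Ω)} (hγ : IsCoupling γ μ ν) :
      W1 (p ∘ₘ μ) (p ∘ₘ ν) ≤ r * ∫⁻ z, edist z.1 z.2 ∂γ := by
    have := hγ.isProbabilityMeasure
    calc W1 (p ∘ₘ μ) (p ∘ₘ ν)
        = W1 (p.comap Prod.fst measurable_fst ∘ₘ γ) (p.comap Prod.snd measurable_snd ∘ₘ γ) := by
          rw [← Kernel.comp_deterministic_eq_comap, ← Kernel.comp_deterministic_eq_comap,
            ← Measure.comp_assoc, ← Measure.comp_assoc, Measure.deterministic_comp_eq_map,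
            Measure.deterministic_comp_eq_map, hγ.1, hγ.2]
      _ ≤ ∫⁻ z, W1 (p z.1) (p z.2) ∂γ := W1_comp_le_lintegral γ _ _
      _ ≤ ∫⁻ z, r * edist z.1 z.2 ∂γ := lintegral_mono fun z ↦ h z.1 z.2
      _ = r * ∫⁻ z, edist z.1 z.2 ∂γ := lintegral_const_mul' _ _ hr
  -- Multiplication by `0` does not commute with the infimum over the proofs of `IsCoupling γ μ ν`,
  -- as `0 * ∞ = 0`.
  obtain rfl | h0 := eq_or_ne r 0
  · simpa using key (isCoupling_prod μ ν)
  · rw [W1.eq_def μ ν, ENNReal.mul_iInf_of_ne h0 hr]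
    refine le_iInf fun γ ↦ ?_
    rw [ENNReal.mul_iInf_of_ne h0 hr]
    exact le_iInf fun hγ ↦ key hγ

lemma W1_comm (μ ν : Measure Ω) : W1 μ ν = W1 ν μ := by
  have key (μ ν : Measure Ω) : W1 μ ν ≤ W1 ν μ := by
    refine le_iInf₂ fun γ hγ ↦ ?_
    refine (W1_le_lintegral (γ := γ.map Prod.swap) ⟨?_, ?_⟩).trans_eq ?_
    · rw [Measure.map_map measurable_fst measurable_swap]
      exact hγ.2
    · rw [Measure.map_map measurable_snd measurable_swap]
      exact hγ.1
    · rw [lintegral_map .of_discrete measurable_swap]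
      simp [edist_comm]
  exact le_antisymm (key μ ν) (key ν μ)

lemma lintegral_edist_le_add_W1 (o : Ω) (μ ν : Measure Ω) :
    ∫⁻ x, edist o x ∂ν ≤ ∫⁻ x, edist o x ∂μ + W1 μ ν := by
  simp only [W1, ENNReal.add_iInf]
  refine le_iInf₂ fun γ hγ ↦ ?_
  rw [← hγ.1, ← hγ.2, lintegral_map .of_discrete measurable_fst,
    lintegral_map .of_discrete measurable_snd, ← lintegral_add_left .of_discrete]
  exact lintegral_mono fun z ↦ edist_triangle _ _ _

end Wasserstein

/-! ### Relative entropy along one step of a kernel -/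

section Entropy

lemma sq_lintegral_le_lintegral_sq {α : Type*} [MeasurableSpace α] (μ : Measure α)
    [IsProbabilityMeasure μ] {f : α → ℝ≥0∞} (hf : AEMeasurable f μ) :
    (∫⁻ x, f x ∂μ) ^ 2 ≤ ∫⁻ x, f x ^ 2 ∂μ := by
  have h := ENNReal.lintegral_mul_le_Lp_mul_Lq μ Real.HolderConjugate.two_two hf
    (aemeasurable_const (b := (1 : ℝ≥0∞)))
  simp only [Pi.mul_apply, mul_one, lintegral_const, measure_univ,
    ENNReal.rpow_two, one_pow, ENNReal.one_rpow] at h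
  calc (∫⁻ x, f x ∂μ) ^ 2 ≤ ((∫⁻ x, f x ^ 2 ∂μ) ^ (1 / 2 : ℝ)) ^ 2 := by gcongr
    _ = ∫⁻ x, f x ^ 2 ∂μ := by
      rw [← ENNReal.rpow_two, ← ENNReal.rpow_mul]; norm_num

/-- The conditional relative entropy bounds the average relative entropy of the kernels. -/
lemma lintegral_klDiv_le {α β : Type*} [MeasurableSpace α] [MeasurableSpace β]
    [MeasurableSpace.CountableOrCountablyGenerated α β]
    (μ : Measure α) [IsFiniteMeasure μ] (κ η : Kernel α β) [IsMarkovKernel κ] [IsMarkovKernel η] :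
    ∫⁻ x, klDiv (κ x) (η x) ∂μ ≤ klDiv (μ ⊗ₘ κ) (μ ⊗ₘ η) := by
  by_cases h_ac : μ ⊗ₘ κ ≪ μ ⊗ₘ η
  swap; · simp [klDiv_of_not_ac h_ac]
  have hκη : ∀ᵐ x ∂μ, κ x ≪ η x := h_ac.kernel_of_compProd
  have hd : ∀ᵐ x ∂μ, κ x = η.withDensity (κ.rnDeriv η) x := by
    filter_upwards [hκη] with x hx using (Kernel.withDensity_rnDeriv_eq hx).symm
  have hm : Measurable (Function.uncurry (κ.rnDeriv η)) := Kernel.measurable_rnDeriv κ η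
  have hcp : μ ⊗ₘ κ = (μ ⊗ₘ η).withDensity (fun z ↦ κ.rnDeriv η z.1 z.2) := by
    rw [Measure.compProd_congr hd, Measure.compProd_withDensity hm]
  have hrn : (μ ⊗ₘ κ).rnDeriv (μ ⊗ₘ η) =ᵐ[μ ⊗ₘ η] fun z ↦ κ.rnDeriv η z.1 z.2 := by
    rw [hcp]
    exact Measure.rnDeriv_withDensity _ hm
  rw [klDiv_eq_lintegral_klFun_of_ac h_ac]
  rw [lintegral_congr_ae (μ := μ ⊗ₘ η)
    (g := fun z : α × β ↦ ENNReal.ofReal (klFun (κ.rnDeriv η z.1 z.2).toReal))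
    (by filter_upwards [hrn] with z hz; rw [hz])]
  rw [Measure.lintegral_compProd (by fun_prop)]
  refine lintegral_mono_ae ?_
  filter_upwards [hκη] with x hx
  rw [klDiv_eq_lintegral_klFun_of_ac hx]
  refine (lintegral_congr_ae ?_).le
  filter_upwards [Kernel.rnDeriv_eq_rnDeriv_measure (κ := κ) (η := η) (a := x)] with y hy
  rw [hy]

/-- Time reversal of one step of a stationary chain. If `ν` is the law of the chain at time `1`
after a change of measure depending only on the time-`1` state, then `ν'` is the law at time `0` and
`q` the transition kernel under the new measure. The entropy splits along the step. -/
lemma exists_kernel_klDiv_add_le {α : Type*} [MeasurableSpace α] [StandardBorelSpace α]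
    {p : Kernel α α} [IsMarkovKernel p] {π : Measure α} [IsProbabilityMeasure π]
    (hπ : p.Invariant π) (ν : Measure α) [IsProbabilityMeasure ν] :
    ∃ (ν' : Measure α) (q : Kernel α α), IsProbabilityMeasure ν' ∧ IsMarkovKernel q ∧
      q ∘ₘ ν' = ν ∧ (∀ K : ℝ≥0∞, ν ≤ K • π → ν' ≤ K • π) ∧
      klDiv ν' π + ∫⁻ x, klDiv (q x) (p x) ∂ν' ≤ klDiv ν π := by
  have : Nonempty α := nonempty_of_isProbabilityMeasure π
  have hbπ : π ⊗ₘ p†π = (π ⊗ₘ p).map Prod.swap := by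
    have := compProd_posterior_eq_map_swap (κ := p) (μ := π)
    rwa [hπ.def] at this
  have hbπ' : p†π ∘ₘ π = π := by
    rw [← Measure.snd_compProd, hbπ, Measure.snd_map_swap, Measure.fst_compProd]
  set Q := (ν ⊗ₘ p†π).map Prod.swap with hQ
  have : IsProbabilityMeasure Q := Measure.isProbabilityMeasure_map measurable_swap.aemeasurable
  have hQfst : Q.fst = p†π ∘ₘ ν := by rw [hQ, Measure.fst_map_swap, Measure.snd_compProd]
  have hdis : (p†π ∘ₘ ν) ⊗ₘ Q.condKernel = Q := by rw [← hQfst]; exact Q.disintegrate _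
  refine ⟨p†π ∘ₘ ν, Q.condKernel, inferInstance, inferInstance, ?_, fun K hK ↦ ?_, ?_⟩
  · rw [← Measure.snd_compProd, hdis, hQ, Measure.snd_map_swap, Measure.fst_compProd]
  · refine Measure.le_iff.2 fun s hs ↦ ?_
    conv_rhs => rw [← hbπ']
    rw [Measure.smul_apply, Measure.bind_apply hs (Kernel.aemeasurable _),
      Measure.bind_apply hs (Kernel.aemeasurable _), smul_eq_mul, ← smul_eq_mul,
      ← lintegral_smul_measure]
    exact lintegral_mono' hK le_rfl
  · calc klDiv (p†π ∘ₘ ν) π + ∫⁻ x, klDiv (Q.condKernel x) (p x) ∂(p†π ∘ₘ ν)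
        ≤ klDiv (p†π ∘ₘ ν) π
          + klDiv ((p†π ∘ₘ ν) ⊗ₘ Q.condKernel) ((p†π ∘ₘ ν) ⊗ₘ p) := by
          gcongr
          exact lintegral_klDiv_le _ _ _
      _ = klDiv Q (π ⊗ₘ p) := by rw [← klDiv_compProd_eq_add, hdis]
      _ = klDiv Q ((π ⊗ₘ p†π).map Prod.swap) := by
          rw [hbπ, Measure.map_map measurable_swap measurable_swap]; simp
      _ ≤ klDiv (ν ⊗ₘ p†π) (π ⊗ₘ p†π) := klDiv_map_le _ _ measurable_swap
      _ = klDiv ν π := klDiv_compProd_left _ _ _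

end Entropy

/-! ### Consequences of positive curvature -/

section Contraction

variable {Ω : Type*} [MetricSpace Ω] [MeasurableSpace Ω]

/-- The supremum defining the coarse Ricci curvature is attained. -/
lemma W1_le_of_le_coarseRicciCurvature {p : Kernel Ω Ω} {k : ℝ}
    (h : (k : EReal) ≤ coarseRicciCurvature p) (x y : Ω) :
    W1 (p x) (p y) ≤ ENNReal.ofReal (1 - k) * edist x y := by
  have hlt (j : ℝ) (hj : j < k) : W1 (p x) (p y) ≤ ENNReal.ofReal (1 - j) * edist x y := by
    obtain ⟨κ, hκ⟩ := lt_iSup_iff.1 ((EReal.coe_lt_coe_iff.2 hj).trans_le h)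
    obtain ⟨⟨-, hW⟩, hjκ⟩ := lt_iSup_iff.1 hκ
    refine (hW x y).trans ?_
    gcongr
    exact (EReal.coe_lt_coe_iff.1 hjκ).le
  have hlim : Tendsto (fun j : ℝ ↦ ENNReal.ofReal (1 - j) * edist x y) (𝓝[<] k)
      (𝓝 (ENNReal.ofReal (1 - k) * edist x y)) := by
    refine ENNReal.Tendsto.mul_const ?_ (Or.inr (edist_ne_top x y))
    refine (ENNReal.continuous_ofReal.tendsto _).comp ?_
    exact ((continuous_const.sub continuous_id).tendsto k).mono_left nhdsWithin_le_nhds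
  exact ge_of_tendsto hlim (eventually_nhdsWithin_of_forall hlt)

lemma le_one_of_le_coarseRicciCurvature {p : Kernel Ω Ω} {k : ℝ}
    (h : (k : EReal) ≤ coarseRicciCurvature p) : k ≤ 1 :=
  EReal.coe_le_coe_iff.1 (h.trans (iSup₂_le fun _ hκ ↦ EReal.coe_le_coe_iff.2 hκ.1))

variable [Countable Ω] [BorelSpace Ω]

/-- A law satisfying `(T₁)` is at finite distance from the Dirac mass at any of its atoms, whose
relative entropy is finite. -/
lemma SatisfiesT1.lintegral_edist_ne_top {μ : Measure Ω} [IsProbabilityMeasure μ] {C : ℝ}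
    (h : SatisfiesT1 μ C) (o : Ω) : ∫⁻ x, edist o x ∂μ ≠ ∞ := by
  obtain ⟨y, hy⟩ : ∃ y, μ {y} ≠ 0 := by
    by_contra! h0
    have : μ Set.univ = 0 := by
      rw [← Set.biUnion_of_singleton Set.univ]
      exact (measure_biUnion_null_iff Set.countable_univ).2 fun y _ ↦ h0 y
    simp at this
  have hac : Measure.dirac y ≪ μ := by
    refine Measure.AbsolutelyContinuous.mk fun s hs h0 ↦ ?_
    rw [Measure.dirac_apply' _ hs, Set.indicator_of_notMem]
    exact fun hys ↦ hy (measure_mono_null (Set.singleton_subset_iff.2 hys) h0)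
  have hkl : klDiv (Measure.dirac y) μ ≠ ∞ := klDiv_ne_top hac (integrable_dirac (by simp))
  have hW : W1 μ (Measure.dirac y) ≠ ∞ := by
    intro htop
    have := h _ inferInstance hkl
    rw [htop] at this
    exact absurd this (by simpa using ENNReal.mul_ne_top ENNReal.ofReal_ne_top hkl)
  refine ne_top_of_le_ne_top ?_ (lintegral_edist_le_add_W1 o (Measure.dirac y) μ)
  rw [W1_comm]
  simp [hW, edist_ne_top]

/-- A stationary law of a contracting kernel has a finite first moment. With `V = d(o, ·)` and
`e = ∫ V dp(o)`, contraction gives `pV ≤ e + r V`; by stationarity the truncations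
`a n = ∫ min (rⁿ V) R dπ` satisfy `a n ≤ rⁿ e + a (n + 1)`, and `a n → 0`. -/
lemma lintegral_edist_ne_top_of_invariant {p : Kernel Ω Ω} [IsMarkovKernel p] {r : ℝ≥0∞}
    (hr : r < 1) (h : ∀ x y, W1 (p x) (p y) ≤ r * edist x y) {π : Measure Ω}
    [IsProbabilityMeasure π] (hπ : p.Invariant π) (o : Ω) (ho : ∫⁻ x, edist o x ∂p o ≠ ∞) :
    ∫⁻ x, edist o x ∂π ≠ ∞ := by
  set e := ∫⁻ x, edist o x ∂p o with he
  have hdrift (x : Ω) : ∫⁻ y, edist o y ∂p x ≤ e + r * edist o x :=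
    (lintegral_edist_le_add_W1 o (p o) (p x)).trans (by gcongr; exact h o x)
  have hstep (R c : ℝ≥0∞) : ∫⁻ x, min (c * edist o x) R ∂π
      ≤ c * e + ∫⁻ x, min (c * r * edist o x) R ∂π := by
    conv_lhs => rw [← hπ.def]
    rw [Measure.lintegral_bind (Kernel.aemeasurable _) Measurable.of_discrete.aemeasurable]
    calc ∫⁻ x, ∫⁻ y, min (c * edist o y) R ∂p x ∂π
        ≤ ∫⁻ x, (c * e + min (c * r * edist o x) R) ∂π := by
          refine lintegral_mono fun x ↦ ?_
          calc ∫⁻ y, min (c * edist o y) R ∂p x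
              ≤ min (∫⁻ y, c * edist o y ∂p x) (∫⁻ _, R ∂p x) :=
                le_min (lintegral_mono fun _ ↦ min_le_left _ _)
                  (lintegral_mono fun _ ↦ min_le_right _ _)
            _ ≤ min (c * (e + r * edist o x)) R := by
                rw [lintegral_const_mul _ .of_discrete]
                gcongr
                · exact hdrift x
                · simp
            _ ≤ c * e + min (c * r * edist o x) R := by
                rw [mul_add, ← mul_assoc, ← min_add_add_left]
                exact min_le_min le_rfl le_add_self
      _ = c * e + ∫⁻ x, min (c * r * edist o x) R ∂π := by
          rw [lintegral_add_left measurable_const]; simp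
  have hiter (R : ℝ≥0∞) (n : ℕ) : ∫⁻ x, min (edist o x) R ∂π
      ≤ (∑ k ∈ Finset.range n, r ^ k) * e + ∫⁻ x, min (r ^ n * edist o x) R ∂π := by
    induction n with
    | zero => simp
    | succ n ih =>
      refine ih.trans ?_
      rw [Finset.sum_range_succ, add_mul, add_assoc, pow_succ]
      gcongr
      exact hstep R (r ^ n)
  have htrunc (R : ℝ≥0∞) (hR : R ≠ ∞) : ∫⁻ x, min (edist o x) R ∂π ≤ (1 - r)⁻¹ * e := by
    have hlim : Tendsto (fun n : ℕ ↦ ∫⁻ x, min (r ^ n * edist o x) R ∂π) atTop (𝓝 0) := by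
      have := tendsto_lintegral_of_dominated_convergence (μ := π)
        (F := fun (n : ℕ) x ↦ min (r ^ n * edist o x) R) (f := fun _ ↦ 0) (fun _ ↦ R)
        (fun n ↦ .of_discrete) (fun n ↦ ae_of_all _ fun x ↦ min_le_right _ _) (by simpa using hR)
        (ae_of_all _ fun x ↦ ?_)
      · simpa using this
      · have h1 : Tendsto (fun n : ℕ ↦ r ^ n * edist o x) atTop (𝓝 0) := by
          simpa using ENNReal.Tendsto.mul_const (ENNReal.tendsto_pow_atTop_nhds_zero_of_lt_one hr)
            (Or.inr (edist_ne_top o x))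
        simpa using h1.min (tendsto_const_nhds (x := R))
    refine ge_of_tendsto' (by simpa using hlim.const_add ((1 - r)⁻¹ * e)) fun n ↦ ?_
    refine (hiter R n).trans ?_
    gcongr
    rw [← ENNReal.tsum_geometric]
    exact ENNReal.sum_le_tsum _
  have hsup : ∫⁻ x, edist o x ∂π ≤ (1 - r)⁻¹ * e := by
    have hlim : Tendsto (fun n : ℕ ↦ ∫⁻ x, min (edist o x) n ∂π) atTop
        (𝓝 (∫⁻ x, edist o x ∂π)) := by
      refine lintegral_tendsto_of_tendsto_of_monotone (fun _ ↦ Measurable.of_discrete.aemeasurable)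
        (ae_of_all _ fun x m n hmn ↦ min_le_min le_rfl (by exact_mod_cast hmn))
        (ae_of_all _ fun x ↦ ?_)
      simpa using (tendsto_const_nhds (x := edist o x)).min ENNReal.tendsto_nat_nhds_top
    exact le_of_tendsto' hlim fun n ↦ htrunc n (by simp)
  refine ne_top_of_le_ne_top (ENNReal.mul_ne_top ?_ ho) hsup
  exact ENNReal.inv_ne_top.2 (tsub_pos_iff_lt.2 hr).ne'

/-- One step of the recursion for `W₁(π, ν)`: `ν'` is the law one time step earlier, `E` the average
entropy of the tilted transitions, and `D` the resulting transport cost. -/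
lemma exists_W1_le_add {p : Kernel Ω Ω} [IsMarkovKernel p] {r : ℝ≥0∞}
    (hr : r ≠ ∞) (h : ∀ x y, W1 (p x) (p y) ≤ r * edist x y) {C : ℝ}
    (hT1 : ∀ x, SatisfiesT1 (p x) C) {π : Measure Ω} [IsProbabilityMeasure π]
    (hπ : p.Invariant π) (ν : Measure Ω) [IsProbabilityMeasure ν] (hν : klDiv ν π ≠ ∞) :
    ∃ (ν' : Measure Ω) (E : ℝ≥0∞), IsProbabilityMeasure ν' ∧
      (∀ K : ℝ≥0∞, ν ≤ K • π → ν' ≤ K • π) ∧ klDiv ν' π + E ≤ klDiv ν π ∧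
      ∃ D, D ^ 2 ≤ ENNReal.ofReal C * E ∧ W1 π ν ≤ r * W1 π ν' + D := by
  obtain ⟨ν', q, _, _, hq, hK, hE⟩ := exists_kernel_klDiv_add_le hπ ν
  refine ⟨ν', _, inferInstance, hK, hE, ∫⁻ x, W1 (p x) (q x) ∂ν', ?_, ?_⟩
  · have hfin : ∀ᵐ x ∂ν', klDiv (q x) (p x) < ∞ := by
      refine ae_lt_top .of_discrete (ne_top_of_le_ne_top hν (le_add_self.trans hE))
    calc (∫⁻ x, W1 (p x) (q x) ∂ν') ^ 2 ≤ ∫⁻ x, W1 (p x) (q x) ^ 2 ∂ν' :=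
          sq_lintegral_le_lintegral_sq ν' Measurable.of_discrete.aemeasurable
      _ ≤ ∫⁻ x, ENNReal.ofReal C * klDiv (q x) (p x) ∂ν' := by
          refine lintegral_mono_ae ?_
          filter_upwards [hfin] with x hx using hT1 x (q x) inferInstance hx.ne
      _ = _ := lintegral_const_mul _ .of_discrete
  · calc W1 π ν = W1 (p ∘ₘ π) (q ∘ₘ ν') := by rw [hπ.def, hq]
      _ ≤ W1 (p ∘ₘ π) (p ∘ₘ ν') + W1 (p ∘ₘ ν') (q ∘ₘ ν') := W1_triangle _ _ _
      _ ≤ r * W1 π ν' + ∫⁻ x, W1 (p x) (q x) ∂ν' :=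
          add_le_add (W1_comp_le_mul hr h π ν') (W1_comp_le_lintegral ν' p q)

/-- Cauchy-Schwarz for the vectors `(√(1 - r²), r)` and `(√(C' a), √(C' b))`. -/
lemma sqrt_add_mul_sqrt_le {C' r a b : ℝ} (hC' : 0 ≤ C') (hr0 : 0 ≤ r) (hr1 : r ≤ 1)
    (ha : 0 ≤ a) (hb : 0 ≤ b) :
    √((1 - r ^ 2) * C' * a) + r * √(C' * b) ≤ √(C' * (b + a)) := by
  have h1 : 0 ≤ 1 - r ^ 2 := by nlinarith
  refine Real.le_sqrt_of_sq_le ?_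
  rw [Real.sqrt_mul (by positivity), Real.sqrt_mul h1, Real.sqrt_mul hC']
  have e1 := Real.sq_sqrt h1
  have e2 := Real.sq_sqrt hC'
  have e3 := Real.sq_sqrt ha
  have e4 := Real.sq_sqrt hb
  set s := √(1 - r ^ 2)
  set c := √C'
  set x := √a
  set y := √b
  rw [← e2, ← e3, ← e4]
  have : c ^ 2 * (y ^ 2 + x ^ 2) - (s * c * x + r * (c * y)) ^ 2
      = c ^ 2 * (s * y - r * x) ^ 2 + c ^ 2 * (1 - s ^ 2 - r ^ 2) * (x ^ 2 + y ^ 2) := by ring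
  rw [e1] at this
  nlinarith [sq_nonneg (c * (s * y - r * x))]

end Contraction

/-! ### Measures of bounded density -/

section Bounded

variable {Ω : Type*} [Countable Ω] [MetricSpace Ω] [MeasurableSpace Ω] [BorelSpace Ω]

/-- The independent coupling bounds `W₁(π, ν)` uniformly over all `ν ≤ K π`. -/
lemma exists_W1_le_ofReal_of_le_smul {π : Measure Ω} [IsProbabilityMeasure π] (o : Ω)
    (ho : ∫⁻ x, edist o x ∂π ≠ ∞) {K : ℝ≥0∞} (hK : K ≠ ∞) :
    ∃ M : ℝ, 0 ≤ M ∧ ∀ (ν : Measure Ω), IsProbabilityMeasure ν → ν ≤ K • π →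
      W1 π ν ≤ ENNReal.ofReal M := by
  set A := ∫⁻ x, edist o x ∂π
  have hfin : A + K * A ≠ ∞ := ENNReal.add_ne_top.2 ⟨ho, ENNReal.mul_ne_top hK ho⟩
  refine ⟨(A + K * A).toReal, ENNReal.toReal_nonneg, fun ν _ hν ↦ ?_⟩
  rw [ENNReal.ofReal_toReal hfin]
  calc W1 π ν ≤ ∫⁻ x, ∫⁻ y, edist x y ∂ν ∂π := W1_le_lintegral_lintegral π ν
    _ ≤ ∫⁻ x, (edist o x + ∫⁻ y, edist o y ∂ν) ∂π := by
      refine lintegral_mono fun x ↦ ?_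
      calc ∫⁻ y, edist x y ∂ν ≤ ∫⁻ y, (edist o x + edist o y) ∂ν :=
            lintegral_mono fun y ↦ edist_triangle_left x y o
        _ = _ := by rw [lintegral_add_left measurable_const]; simp
    _ = A + ∫⁻ y, edist o y ∂ν := by rw [lintegral_add_right _ measurable_const]; simp [A]
    _ ≤ A + K * A := by
      gcongr
      rw [← smul_eq_mul, ← lintegral_smul_measure]
      exact lintegral_mono' hν le_rfl

/-- The transport-entropy inequality for measures of bounded density. The bound
`W₁(π, ν) ≤ √(C' H(ν | π)) + rⁿ M`, with `M` uniform over all `ν ≤ K π`, is proved by induction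
on `n`. -/
lemma W1_le_sqrt_of_le_smul {p : Kernel Ω Ω} [IsMarkovKernel p] {r C' : ℝ}
    (hr0 : 0 ≤ r) (hr1 : r < 1) (hC' : 0 ≤ C')
    (h : ∀ x y, W1 (p x) (p y) ≤ ENNReal.ofReal r * edist x y)
    (hT1 : ∀ x, SatisfiesT1 (p x) ((1 - r ^ 2) * C')) {π : Measure Ω} [IsProbabilityMeasure π]
    (hπ : p.Invariant π) (o : Ω) (ho : ∫⁻ x, edist o x ∂π ≠ ∞) {K : ℝ≥0∞} (hK : K ≠ ∞)
    (ν : Measure Ω) [IsProbabilityMeasure ν] (hνK : ν ≤ K • π) (hν : klDiv ν π ≠ ∞) :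
    W1 π ν ≤ ENNReal.ofReal √(C' * (klDiv ν π).toReal) := by
  obtain ⟨M, hM0, hM⟩ := exists_W1_le_ofReal_of_le_smul o ho hK
  have h1 : 0 ≤ 1 - r ^ 2 := by nlinarith
  have key (n : ℕ) : ∀ ν : Measure Ω, IsProbabilityMeasure ν → ν ≤ K • π → klDiv ν π ≠ ∞ →
      W1 π ν ≤ ENNReal.ofReal (√(C' * (klDiv ν π).toReal) + r ^ n * M) := by
    induction n with
    | zero =>
      intro ν _ hνK _
      refine (hM ν inferInstance hνK).trans (ENNReal.ofReal_le_ofReal ?_)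
      rw [pow_zero, one_mul]
      exact le_add_of_nonneg_left (Real.sqrt_nonneg _)
    | succ n ih =>
      intro ν _ hνK hν
      obtain ⟨ν', E, _, hK', hE, D, hD, hW⟩ :=
        exists_W1_le_add ENNReal.ofReal_ne_top h hT1 hπ ν hν
      have hν' : klDiv ν' π ≠ ∞ := ne_top_of_le_ne_top hν (le_self_add.trans hE)
      have hE' : E ≠ ∞ := ne_top_of_le_ne_top hν (le_add_self.trans hE)
      have hD' : D ≤ ENNReal.ofReal √((1 - r ^ 2) * C' * E.toReal) := by
        rw [← ENNReal.pow_le_pow_left_iff two_ne_zero, ← ENNReal.ofReal_pow (Real.sqrt_nonneg _),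
          Real.sq_sqrt (by positivity), ENNReal.ofReal_mul (by positivity),
          ENNReal.ofReal_toReal hE']
        exact hD
      calc W1 π ν ≤ ENNReal.ofReal r * W1 π ν' + D := hW
        _ ≤ ENNReal.ofReal r * ENNReal.ofReal (√(C' * (klDiv ν' π).toReal) + r ^ n * M)
            + ENNReal.ofReal √((1 - r ^ 2) * C' * E.toReal) := by
          gcongr
          exact ih ν' inferInstance (hK' K hνK) hν'
        _ = ENNReal.ofReal (√((1 - r ^ 2) * C' * E.toReal)
            + r * √(C' * (klDiv ν' π).toReal) + r ^ (n + 1) * M) := by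
          rw [← ENNReal.ofReal_mul hr0, ← ENNReal.ofReal_add (by positivity) (by positivity)]
          congr 1
          ring
        _ ≤ ENNReal.ofReal (√(C' * (klDiv ν π).toReal) + r ^ (n + 1) * M) := by
          gcongr
          refine (sqrt_add_mul_sqrt_le hC' hr0 hr1.le ENNReal.toReal_nonneg
            ENNReal.toReal_nonneg).trans ?_
          gcongr
          rw [← ENNReal.toReal_add hν' hE']
          exact ENNReal.toReal_mono hν hE
  have hlim : Tendsto (fun n : ℕ ↦ ENNReal.ofReal (√(C' * (klDiv ν π).toReal) + r ^ n * M)) atTop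
      (𝓝 (ENNReal.ofReal √(C' * (klDiv ν π).toReal))) := by
    refine (ENNReal.continuous_ofReal.tendsto _).comp ?_
    simpa using ((tendsto_pow_atTop_nhds_zero_of_lt_one hr0 hr1).mul_const M).const_add
      √(C' * (klDiv ν π).toReal)
  exact ge_of_tendsto' hlim fun n ↦ key n ν inferInstance hνK hν

end Bounded

/-! ### Relative entropy under conditioning -/

section Truncation

/-- The density of `ν.restrict s` vanishes off `s`, where `klFun 0 = 1` contributes `π sᶜ`. -/
lemma klDiv_restrict_le {α : Type*} [MeasurableSpace α] (ν π : Measure α) [IsFiniteMeasure ν]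
    [IsFiniteMeasure π] {s : Set α} (hs : MeasurableSet s) :
    klDiv (ν.restrict s) π ≤ klDiv ν π + π sᶜ := by
  by_cases hac : ν ≪ π
  swap; · simp [klDiv_of_not_ac hac]
  rw [klDiv_eq_lintegral_klFun_of_ac hac,
    klDiv_eq_lintegral_klFun_of_ac (Measure.restrict_le_self.absolutelyContinuous.trans hac),
    ← lintegral_indicator_one hs.compl, ← lintegral_add_left (by fun_prop)]
  refine lintegral_mono_ae ?_
  filter_upwards [Measure.rnDeriv_restrict ν π hs] with x hx
  rw [hx]
  by_cases hxs : x ∈ s <;> simp [hxs, klFun_zero]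

/-- As `ν s` and `π s` tend to `1`, the right-hand side tends to the entropy of `ν` itself. -/
lemma klDiv_cond_ne_top_and_toReal_le {α : Type*} [MeasurableSpace α] (ν π : Measure α)
    [IsProbabilityMeasure ν] [IsProbabilityMeasure π] (hν : klDiv ν π ≠ ∞) {s : Set α}
    (hs : MeasurableSet s) (h0 : ν s ≠ 0) :
    klDiv (ν[|s]) π ≠ ∞ ∧ (klDiv (ν[|s]) π).toReal ≤
      (ν.real s)⁻¹ * ((klDiv ν π).toReal + π.real sᶜ) + Real.log (ν.real s)⁻¹ := by
  have hR := klDiv_restrict_le ν π hs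
  have hfin : klDiv ν π + π sᶜ ≠ ∞ := ENNReal.add_ne_top.2 ⟨hν, measure_ne_top _ _⟩
  have hR' := ne_top_of_le_ne_top hfin hR
  obtain ⟨hac, hint⟩ := klDiv_ne_top_iff.1 hR'
  have hpos : 0 < ν.real s := by simpa [measureReal_def] using ENNReal.toReal_pos h0 (measure_ne_top _ _)
  set c : NNReal := (ν s).toNNReal⁻¹ with hc
  have hcr : (c : ℝ) = (ν.real s)⁻¹ := by simp [hc, measureReal_def, ENNReal.toReal]
  have hcond : ν[|s] = c • ν.restrict s := by
    rw [ProbabilityTheory.cond, ENNReal.smul_def, hc, ENNReal.coe_inv,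
      ENNReal.coe_toNNReal (measure_ne_top _ _)]
    simpa [ENNReal.toNNReal_eq_zero_iff] using h0
  have hval := toReal_klDiv_smul_left hac hint c
  rw [← hcond, hcr] at hval
  refine ⟨?_, ?_⟩
  · rw [hcond]
    have hc0 : c ≠ 0 := by simpa [← NNReal.coe_ne_zero, hcr] using hpos.ne'
    refine klDiv_ne_top (hac.smul_left c) ?_
    refine Integrable.smul_measure_nnreal ?_
    rw [integrable_congr (llr_smul_nnreal_left hac c hc0)]
    fun_prop
  · rw [hval]
    have h1 : (ν.real s)⁻¹ * Real.log (ν.real s)⁻¹ * (ν.restrict s).real Set.univ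
        = Real.log (ν.real s)⁻¹ := by
      simp; field_simp
    have h2 : 1 ≤ (ν.real s)⁻¹ := (one_le_inv₀ hpos).2 measureReal_le_one
    have h3 : (klDiv (ν.restrict s) π).toReal ≤ (klDiv ν π).toReal + π.real sᶜ := by
      rw [measureReal_def, ← ENNReal.toReal_add hν (measure_ne_top _ _)]
      exact ENNReal.toReal_mono hfin hR
    rw [h1]
    have h4 := mul_le_mul_of_nonneg_left h3 (zero_le_one.trans h2)
    simp only [probReal_univ, mul_one]
    linarith

end Truncation

/-! ### From bounded to general densities -/

section General

variable {Ω : Type*} [Countable Ω] [MetricSpace Ω] [MeasurableSpace Ω] [BorelSpace Ω]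

/-- Conditioning `ν` on `s` can be coupled with `ν` by moving only the mass outside `s`, which is
redistributed according to `ν[|s]`. -/
lemma W1_cond_le (ν : Measure Ω) [IsProbabilityMeasure ν] {s : Set Ω} (h0 : ν s ≠ 0) (o : Ω) :
    W1 (ν[|s]) ν ≤ ∫⁻ x in sᶜ, edist o x ∂ν + ν sᶜ * ∫⁻ x, edist o x ∂ν[|s] := by
  classical
  have : IsProbabilityMeasure (ν[|s]) := cond_isProbabilityMeasure h0
  have hs : MeasurableSet s := .of_discrete
  -- `κ` keeps the points of `s` and sends the others to a point drawn from `ν[|s]`.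
  let κ : Kernel Ω Ω := Kernel.piecewise hs Kernel.id (Kernel.const Ω (ν[|s]))
  have hκ : κ ∘ₘ ν = ν[|s] := by
    ext t ht
    have h1 : ∀ x, κ x t = s.indicator (t.indicator 1) x + sᶜ.indicator (fun _ ↦ ν[|s] t) x := by
      intro x
      by_cases hx : x ∈ s <;> simp [κ, Kernel.piecewise_apply, hx, Kernel.id_apply,
        Measure.dirac_apply' _ ht]
    rw [Measure.bind_apply ht (Kernel.aemeasurable _)]
    simp_rw [h1]
    rw [lintegral_add_left .of_discrete, lintegral_indicator hs, lintegral_indicator hs.compl,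
      lintegral_indicator_one ht, setLIntegral_const, Measure.restrict_apply ht, Set.inter_comm,
      ← cond_mul_eq_inter hs, ← mul_add, prob_add_prob_compl hs, mul_one]
  calc W1 (ν[|s]) ν = W1 (κ ∘ₘ ν) (Kernel.id ∘ₘ ν) := by rw [hκ, Measure.id_comp]
    _ ≤ ∫⁻ x, W1 (κ x) (Kernel.id x) ∂ν := W1_comp_le_lintegral ν κ Kernel.id
    _ ≤ ∫⁻ x, sᶜ.indicator (fun x ↦ edist o x + ∫⁻ y, edist o y ∂ν[|s]) x ∂ν := by
      refine lintegral_mono fun x ↦ (W1_le_lintegral_lintegral _ _).trans ?_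
      by_cases hx : x ∈ s
      · simp [κ, Kernel.piecewise_apply, hx, Kernel.id_apply]
      · simp only [κ, Kernel.piecewise_apply, hx, Kernel.id_apply, if_false, Kernel.const_apply,
          lintegral_dirac, Set.mem_compl_iff, not_false_eq_true, Set.indicator_of_mem]
        calc ∫⁻ y, edist y x ∂ν[|s] ≤ ∫⁻ y, (edist o x + edist o y) ∂ν[|s] :=
              lintegral_mono fun y ↦ (edist_triangle_left y x o).trans_eq (add_comm _ _)
          _ = _ := by rw [lintegral_add_left measurable_const]; simp
    _ = _ := by
      rw [lintegral_indicator hs.compl, lintegral_add_right _ measurable_const, setLIntegral_const,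
        mul_comm]

/-- The transport-entropy inequality extends from measures of bounded density to all measures, by
conditioning on the sets where the density is at most `n`. -/
lemma satisfiesT1_of_forall_le_smul {π : Measure Ω} [IsProbabilityMeasure π] {C : ℝ} (hC : 0 ≤ C)
    (o : Ω) (ho : ∫⁻ x, edist o x ∂π ≠ ∞)
    (hb : ∀ K : ℝ≥0∞, K ≠ ∞ → ∀ ν : Measure Ω, IsProbabilityMeasure ν → ν ≤ K • π →
      klDiv ν π ≠ ∞ → W1 π ν ≤ ENNReal.ofReal √(C * (klDiv ν π).toReal)) :
    SatisfiesT1 π C := by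
  intro ν _ hν
  have hac : ν ≪ π := (klDiv_ne_top_iff.1 hν).1
  let F (n : ℕ) : Set Ω := {x | ν.rnDeriv π x ≤ n}
  have hF (n) : MeasurableSet (F n) := .of_discrete
  have hFmono : Monotone F := fun m n hmn x hx ↦ by
    simp only [F, Set.mem_ofPred_eq] at hx ⊢
    exact hx.trans (Nat.cast_le.2 hmn)
  have hmem : ∀ x, ν.rnDeriv π x < ∞ → ∀ᶠ n in atTop, x ∈ F n := fun x hx ↦ by
    obtain ⟨n, hn⟩ := ENNReal.exists_nat_gt hx.ne
    filter_upwards [eventually_ge_atTop n] with m hm using hFmono hm hn.le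
  have hlt : ∀ᵐ x ∂π, ν.rnDeriv π x < ∞ := Measure.rnDeriv_lt_top ν π
  have hlim (ρ : Measure Ω) [IsProbabilityMeasure ρ] (hρ : ρ ≪ π) :
      Tendsto (fun n ↦ ρ (F n)) atTop (𝓝 1) := by
    have hU : ρ (⋃ n, F n) = 1 := by
      rw [← measure_univ (μ := ρ)]
      refine measure_congr (eventuallyEq_univ.2 ?_)
      filter_upwards [hρ.ae_le hlt] with x hx using Set.mem_iUnion.2 (hmem x hx).exists
    rw [← hU]
    exact tendsto_measure_iUnion_atTop hFmono
  have hlimc (ρ : Measure Ω) [IsProbabilityMeasure ρ] (hρ : ρ ≪ π) :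
      Tendsto (fun n ↦ ρ (F n)ᶜ) atTop (𝓝 0) := by
    simp_rw [prob_compl_eq_one_sub (hF _)]
    simpa using ENNReal.Tendsto.sub tendsto_const_nhds (hlim ρ hρ) (Or.inl ENNReal.one_ne_top)
  have hreal : Tendsto (fun n ↦ ν.real (F n)) atTop (𝓝 1) := by
    rw [← ENNReal.toReal_one]
    exact (ENNReal.tendsto_toReal ENNReal.one_ne_top).comp (hlim ν hac)
  have hrealc : Tendsto (fun n ↦ π.real (F n)ᶜ) atTop (𝓝 0) := by
    rw [← ENNReal.toReal_zero]
    exact (ENNReal.tendsto_toReal ENNReal.zero_ne_top).comp (hlimc π .rfl)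
  have hpos : ∀ᶠ n in atTop, ν (F n) ≠ 0 := (hlim ν hac).eventually_ne one_ne_zero
  set H := (klDiv ν π).toReal with hH
  let S (n : ℕ) : ℝ := (ν.real (F n))⁻¹ * (H + π.real (F n)ᶜ) + Real.log (ν.real (F n))⁻¹
  have hS : Tendsto S atTop (𝓝 H) := by
    have hinv : Tendsto (fun n ↦ (ν.real (F n))⁻¹) atTop (𝓝 1) := by
      simpa using hreal.inv₀ one_ne_zero
    have h := (hinv.mul (hrealc.const_add H)).add (hinv.log one_ne_zero)
    rwa [add_zero, one_mul, Real.log_one, add_zero] at h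
  have hB : Tendsto (fun n ↦ ENNReal.ofReal √(C * S n)) atTop (𝓝 (ENNReal.ofReal √(C * H))) :=
    (ENNReal.continuous_ofReal.tendsto _).comp
      ((Real.continuous_sqrt.tendsto _).comp (hS.const_mul C))
  have hW : ∀ᶠ n in atTop, W1 π (ν[|F n]) ≤ ENNReal.ofReal √(C * S n) := by
    filter_upwards [hpos] with n hn
    obtain ⟨hfin, hle⟩ := klDiv_cond_ne_top_and_toReal_le ν π hν (hF n) hn
    have hK : ν[|F n] ≤ ((ν (F n))⁻¹ * n) • π := by
      rw [mul_smul, ProbabilityTheory.cond]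
      gcongr
      refine Measure.le_iff.2 fun t ht ↦ ?_
      calc ν.restrict (F n) t = ∫⁻ x in t ∩ F n, ν.rnDeriv π x ∂π := by
            rw [Measure.restrict_apply ht, Measure.setLIntegral_rnDeriv hac]
        _ ≤ ∫⁻ _ in t ∩ F n, n ∂π := setLIntegral_mono measurable_const fun x hx ↦ hx.2
        _ ≤ n * π t := by
            rw [setLIntegral_const]
            gcongr
            exact Set.inter_subset_left
    refine (hb _ (ENNReal.mul_ne_top (ENNReal.inv_ne_top.2 hn) (ENNReal.natCast_ne_top n)) _
      (cond_isProbabilityMeasure hn) hK hfin).trans ?_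
    gcongr
  have hmom : ∀ᶠ n in atTop, ∫⁻ x, edist o x ∂ν[|F n]
      ≤ ∫⁻ x, edist o x ∂π + ENNReal.ofReal √(C * S n) := by
    filter_upwards [hW] with n hn
    exact (lintegral_edist_le_add_W1 o π _).trans (by gcongr)
  -- The first moments over `F n` stay bounded, so that `ν` has a finite first moment.
  have hVν : ∫⁻ x, edist o x ∂ν ≠ ∞ := by
    have hl : Tendsto (fun n ↦ ∫⁻ x, (F n).indicator (edist o) x ∂ν) atTop
        (𝓝 (∫⁻ x, edist o x ∂ν)) := by
      refine lintegral_tendsto_of_tendsto_of_monotone (fun _ ↦ Measurable.of_discrete.aemeasurable)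
        (ae_of_all _ fun x m n hmn ↦
          Set.indicator_le_indicator_of_subset (hFmono hmn) (fun _ ↦ zero_le) x) ?_
      filter_upwards [hac.ae_le hlt] with x hx
      refine tendsto_const_nhds.congr' ?_
      filter_upwards [hmem x hx] with n hn
      rw [Set.indicator_of_mem hn]
    refine ne_top_of_le_ne_top (ENNReal.add_ne_top.2 ⟨ho, ENNReal.ofReal_ne_top⟩)
      (le_of_tendsto_of_tendsto hl (hB.const_add (∫⁻ x, edist o x ∂π)) ?_)
    filter_upwards [hmom] with n hn
    refine le_trans ?_ hn
    rw [lintegral_indicator (hF n), ProbabilityTheory.cond, lintegral_smul_measure, smul_eq_mul]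
    exact le_mul_of_one_le_left zero_le (ENNReal.one_le_inv.2 prob_le_one)
  have hfinal : W1 π ν ≤ ENNReal.ofReal √(C * H) := by
    have hl : Tendsto (fun n ↦ ENNReal.ofReal √(C * S n) + (∫⁻ x in (F n)ᶜ, edist o x ∂ν
        + ν (F n)ᶜ * (∫⁻ x, edist o x ∂π + ENNReal.ofReal √(C * S n)))) atTop
        (𝓝 (ENNReal.ofReal √(C * H))) := by
      have h1 := tendsto_setLIntegral_zero hVν (hlimc ν hac)
      have h2 := ENNReal.Tendsto.mul (hlimc ν hac)
        (Or.inr (ENNReal.add_ne_top.2 ⟨ho, ENNReal.ofReal_ne_top⟩))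
        (hB.const_add (∫⁻ x, edist o x ∂π)) (Or.inr ENNReal.zero_ne_top)
      simpa using hB.add (h1.add h2)
    refine ge_of_tendsto hl ?_
    filter_upwards [hpos, hW, hmom] with n hn hWn hmn
    have : IsProbabilityMeasure (ν[|F n]) := cond_isProbabilityMeasure hn
    refine (W1_triangle π (ν[|F n]) ν).trans (add_le_add hWn ?_)
    exact (W1_cond_le ν hn o).trans (by gcongr)
  calc W1 π ν ^ 2 ≤ ENNReal.ofReal √(C * H) ^ 2 := by gcongr
    _ = ENNReal.ofReal C * klDiv ν π := by
      rw [← ENNReal.ofReal_pow (Real.sqrt_nonneg _),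
        Real.sq_sqrt (mul_nonneg hC ENNReal.toReal_nonneg), ENNReal.ofReal_mul hC,
        ENNReal.ofReal_toReal hν]

end General

theorem theorem1 {Ω : Type*} [Countable Ω] [MetricSpace Ω] [MeasurableSpace Ω] [BorelSpace Ω]
    (p : Kernel Ω Ω) [IsMarkovKernel p] (α C : ℝ) (hα : 0 < α) (hC : 0 ≤ C)
    (hcurv : ((1 / α : ℝ) : EReal) ≤ coarseRicciCurvature p)
    (hT1 : ∀ x : Ω, SatisfiesT1 (p x) C)
    (π : Measure Ω) [IsProbabilityMeasure π] (hπ : p.Invariant π) :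
    SatisfiesT1 π (C * α / (2 - 1 / α)) := by
  obtain ⟨o⟩ : Nonempty Ω := nonempty_of_isProbabilityMeasure π
  have hle : 1 / α ≤ 1 := le_one_of_le_coarseRicciCurvature hcurv
  have hk : 0 < 1 / α := by positivity
  have hcontr := W1_le_of_le_coarseRicciCurvature hcurv
  have h2 : 0 < 2 - 1 / α := by linarith
  have hC' : 0 ≤ C * α / (2 - 1 / α) := by positivity
  have hCeq : (1 - (1 - 1 / α) ^ 2) * (C * α / (2 - 1 / α)) = C := by
    have : 1 - (1 - 1 / α) ^ 2 = 1 / α * (2 - 1 / α) := by ring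
    rw [this]
    generalize 2 - 1 / α = t at h2
    field_simp
  have ho := lintegral_edist_ne_top_of_invariant (by simpa using hk) hcontr hπ o
    ((hT1 o).lintegral_edist_ne_top o)
  refine satisfiesT1_of_forall_le_smul hC' o ho fun K hK ν _ hνK hν ↦ ?_
  refine W1_le_sqrt_of_le_smul (r := 1 - 1 / α) (by linarith) (by linarith) hC' hcontr
    (fun x ↦ ?_) hπ o ho hK ν hνK hν
  rw [hCeq]
  exact hT1 x
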